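/- Let $N\ge 0$ be an integer. Let $Z,f,A_i,f_i\in\mathbb R[[x]]$ be formal power series and $g,h,g_{ij},h_{ijk}\in\mathbb R[x]$ polynomials ($i,j,k\in\{1,\dots,N\}$) with $$Z=f+gZ+hZ^2,\qquad A_i=f_i+\sum_{j=1}^N g_{ij}A_j+\sum_{j,k=1}^N h\,h_{ijk}A_jA_k\quad(1\le i\le N).$$ Write $F_n$ for the coefficient of $x^n$ in a power series $F$, and put $F^{\le s}(x)=\sum_{n=0}^sF_nx^n$. Assume that there are real numbers $r,\gamma,\gamma_1,\dots,\gamma_N$ such that $$\lim_{n\to\infty}\frac{Z_{n+1}}{Z_n}=\frac1r>1,\qquad \lim_{n\to\infty}\frac{f_n}{Z_n}=\gamma,\qquad \lim_{n\to\infty}\frac{f_{i,n}}{Z_n}=\gamma_i\quad(1\le i\le N).$$ Assume that $(Z,A_1,\dots,A_N)$ is a natural partition system, i.e. $$Z=\sum_{i=1}^N A_i,\qquad f=\sum_{i=1}^N f_i,\qquad g=\sum_{i=1}^N g_{ij}\ \text{ for every } j,\qquad 2=\sum_{i=1}^N(h_{ijk}+h_{ikj})\ \text{ for all } j,k,$$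 and that it is nonnegative, i.e. all coefficients of $Z,A_i,g,h,g_{ij},h_{ijk}$ and all the numbers $\gamma,\gamma_i$ are nonnegative. For an integer $s\ge 0$ put $\zeta_s=1-\gamma-g(r)-2h(r)Z^{\le s}(r)$, and let the $s$-cut operator $C_s:\mathbb R^N\to\mathbb R^N$, $(x_1,\dots,x_N)\mapsto(c_1,\dots,c_N)$, be given by $$c_i=\gamma_i+\sum_{j=1}^N g_{ij}(r)x_j+\sum_{j,k=1}^N h(r)h_{ijk}(r)\bigl(A_j^{\le s}(r)x_k+A_k^{\le s}(r)x_j\bigr)+\sum_{j,k=1}^N\zeta_s h_{ijk}(r)x_jx_k .$$ Then, for every integer $s\ge0$, the operator $C_s$ maps $$H=\Bigl\{(x_1,\dots,x_N)\in\mathbb R^N:\ 0\le x_i\le 1,\ \sum_{i=1}^N x_i=1\Bigr\}$$ into itself, and $C_s$ has a fixed point (an $s$-cut solution) in $H$. -/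

import Mathlib

open Filter Topology

noncomputable section

/-- The data of a base series `Z = f + g Z + h Z ^ 2` together with `N` further series `A i`,
where `A i = fA i + ∑ j, gA i j * A j + ∑ j k, h * hA i j k * A j * A k`, and of the
numbers `r`, `γ`, `γA i` attached to them. The equations and the limits that these objects have to
satisfy are collected in `QuadSystem.IsQuadratic` below. -/
structure QuadSystem (N : ℕ) where
  /-- the base series -/
  Z : PowerSeries ℝ
  /-- constant term of the equation of `Z` -/
  f : PowerSeries ℝ
  /-- linear coefficient of the equation of `Z` -/
  g : Polynomial ℝ
  /-- quadratic coefficient of the equation of `Z` -/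
  h : Polynomial ℝ
  /-- the series `A_1, …, A_N` -/
  A : Fin N → PowerSeries ℝ
  /-- the series `f_i` -/
  fA : Fin N → PowerSeries ℝ
  /-- the polynomials `g_{ij}` -/
  gA : Fin N → Fin N → Polynomial ℝ
  /-- the polynomials `h_{ijk}` -/
  hA : Fin N → Fin N → Fin N → Polynomial ℝ
  /-- `1 / r` is the limit of `Z_{n+1} / Z_n` -/
  r : ℝ
  /-- the limit of `f_n / Z_n` -/
  γ : ℝ
  /-- the limits of `f_{i,n} / Z_n` -/
  γA : Fin N → ℝ

namespace QuadSystem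

variable {N : ℕ}

/-- The equations of the system, and the limits that define `r`, `γ` and `γA`. Since the limit of
`Z_{n+1} / Z_n` is nonzero, only finitely many of the quotients below have denominator `0`. -/
structure IsQuadratic (S : QuadSystem N) : Prop where
  eq_Z : S.Z = S.f + (S.g : PowerSeries ℝ) * S.Z + (S.h : PowerSeries ℝ) * S.Z ^ 2
  eq_A : ∀ i, S.A i = S.fA i + ∑ j, (S.gA i j : PowerSeries ℝ) * S.A j
    + ∑ j, ∑ k, (S.h : PowerSeries ℝ) * (S.hA i j k : PowerSeries ℝ) * S.A j * S.A k
  one_lt : 1 < 1 / S.r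
  tendsto_r : Tendsto (fun n : ℕ => PowerSeries.coeff (n + 1) S.Z / PowerSeries.coeff n S.Z)
    atTop (𝓝 (1 / S.r))
  tendsto_γ : Tendsto (fun n : ℕ => PowerSeries.coeff n S.f / PowerSeries.coeff n S.Z)
    atTop (𝓝 S.γ)
  tendsto_γA : ∀ i, Tendsto
    (fun n : ℕ => PowerSeries.coeff n (S.fA i) / PowerSeries.coeff n S.Z) atTop (𝓝 (S.γA i))

/-- The series `A_1, …, A_N` form a natural partition of `Z`. -/
structure IsNaturalPartition (S : QuadSystem N) : Prop where
  sum_A : S.Z = ∑ i, S.A i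
  sum_f : S.f = ∑ i, S.fA i
  sum_g : ∀ j, S.g = ∑ i, S.gA i j
  sum_h : ∀ j k, 2 = ∑ i, (S.hA i j k + S.hA i k j)

/-- All coefficients of `Z, A_i, g, h, g_{ij}, h_{ijk}` and all of `γ, γ_i` are nonnegative. -/
structure IsNonneg (S : QuadSystem N) : Prop where
  Z_nonneg : ∀ n, 0 ≤ PowerSeries.coeff n S.Z
  A_nonneg : ∀ i n, 0 ≤ PowerSeries.coeff n (S.A i)
  g_nonneg : ∀ n, 0 ≤ S.g.coeff n
  h_nonneg : ∀ n, 0 ≤ S.h.coeff n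
  gA_nonneg : ∀ i j n, 0 ≤ (S.gA i j).coeff n
  hA_nonneg : ∀ i j k n, 0 ≤ (S.hA i j k).coeff n
  γ_nonneg : 0 ≤ S.γ
  γA_nonneg : ∀ i, 0 ≤ S.γA i

/-- `F^{≤ s}(r) = ∑_{n = 0}^{s} F_n r ^ n`. -/
def cutEval (F : PowerSeries ℝ) (s : ℕ) (r : ℝ) : ℝ :=
  ∑ n ∈ Finset.range (s + 1), PowerSeries.coeff n F * r ^ n

/-- `ζ_s = 1 - γ - g(r) - 2 h(r) Z^{≤ s}(r)`. -/
def zeta (S : QuadSystem N) (s : ℕ) : ℝ :=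
  1 - S.γ - S.g.eval S.r - 2 * S.h.eval S.r * cutEval S.Z s S.r

/-- The `s`-cut operator `C_s` on `ℝ^N`. -/
def cutOperator (S : QuadSystem N) (s : ℕ) (x : Fin N → ℝ) : Fin N → ℝ := fun i =>
  S.γA i + ∑ j, (S.gA i j).eval S.r * x j
    + ∑ j, ∑ k, S.h.eval S.r * (S.hA i j k).eval S.r
        * (cutEval (S.A j) s S.r * x k + cutEval (S.A k) s S.r * x j)
    + ∑ j, ∑ k, S.zeta s * (S.hA i j k).eval S.r * x j * x k

/-- An `s`-cut solution is a solution of the `s`-cut equations, i.e. a fixed point of `C_s`. -/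
def IsCutSolution (S : QuadSystem N) (s : ℕ) (x : Fin N → ℝ) : Prop :=
  Function.IsFixedPt (S.cutOperator s) x

end QuadSystem

/-- `H = {x ∈ [0,1]^N : ∑ x_i = 1}`. -/
def unitSimplex (N : ℕ) : Set (Fin N → ℝ) :=
  {x | (∀ i, 0 ≤ x i ∧ x i ≤ 1) ∧ ∑ i, x i = 1}

end

/-! ### Determinants of perturbations of the identity -/

/-! Summing the components of `C_s` over `i`, the partition identities leave γ + g(r) +
2h(r)Z^{≤s}(r) + ζ_s, which is 1 by the choice of ζ_s. For invariance of `H` it remains to see that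
ζ_s ≥ 0 (`zeta_nonneg`). Divide the n-th coefficient of Z = f + gZ + hZ² by Z_n: since Z_{n-m}/Z_n →
r^m, and the terms of Z² with one index at most s occur in mirror pairs, the limit gives γ + g(r) +
2h(r)Z^{≤s}(r) ≤ 1.

The fixed point comes from Brouwer's theorem, proved here analytically. If a C¹ map f retracted a
ball onto its sphere, put g = f - id. For small t the map id + tg permutes the ball, so ∫ det(1 + t
Dg) is the volume of the ball; being polynomial in t, it equals the volume at t = 1 too. There,
however, Df is singular everywhere. A fixed-point-free map would yield such a retraction by
following rays to the sphere. The simplex is reached through smooth approximate retractions and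
compactness. -/

theorem exists_polynomial_eval_eq_det_one_add_smul {E : Type*} [NormedAddCommGroup E]
    [NormedSpace ℝ E] [FiniteDimensional ℝ E] (f : E →L[ℝ] E) :
    ∃ p : Polynomial ℝ, p.natDegree ≤ Module.finrank ℝ E ∧
      ∀ t : ℝ, p.eval t = (1 + t • f).det := by
  classical
  let b := Module.finBasis ℝ E
  let M := LinearMap.toMatrix b b (f : E →ₗ[ℝ] E)
  refine ⟨((Polynomial.X : Polynomial ℝ) • M.map Polynomial.C +
    (1 : Matrix _ _ ℝ).map Polynomial.C).det, ?_, fun t => ?_⟩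
  · simpa using Polynomial.natDegree_det_X_add_C_le M 1
  · have h : (1 + t • f).det = (1 + t • M).det := by
      rw [ContinuousLinearMap.det, ← LinearMap.det_toMatrix b]
      congr 1
      rw [ContinuousLinearMap.toLinearMap_add, ContinuousLinearMap.toLinearMap_smul, map_add,
        map_smul]
      congr 1
      exact LinearMap.toMatrix_one b
    rw [h, ← Polynomial.coe_evalRingHom, RingHom.map_det]
    congr 1
    ext i j
    by_cases hij : i = j <;> simp [hij, add_comm, mul_comm _ t]

/-- Extrapolation of polynomials of bounded degree from arguments close to `0` to `1`. -/
theorem exists_extrapolation_weights (d : ℕ) {δ : ℝ} (hδ : 0 < δ) :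
    ∃ (s : Finset ℝ) (w : ℝ → ℝ), (∀ t ∈ s, 0 < t ∧ t < δ) ∧
      ∀ p : Polynomial ℝ, p.natDegree ≤ d → p.eval 1 = ∑ t ∈ s, w t * p.eval t := by
  obtain ⟨s, hs, hcard⟩ := (Set.Ioo_infinite hδ).exists_subset_card_eq (d + 1)
  refine ⟨s, fun t => (Lagrange.basis s id t).eval 1, fun t ht => hs ht, fun p hp => ?_⟩
  have hdeg : p.degree < s.card := by
    rw [hcard]
    exact Polynomial.degree_le_natDegree.trans_lt (by exact_mod_cast Nat.lt_succ_of_le hp)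
  conv_lhs => rw [Lagrange.eq_interpolate (v := id) (Set.injOn_id _) hdeg]
  rw [Lagrange.interpolate_apply, Polynomial.eval_finsetSum]
  exact Finset.sum_congr rfl fun t _ => by simp [mul_comm]

/-- By the Neumann series `1 + t • f` is invertible for all t in [0,1], so its determinant keeps the
sign it has at t = 0. -/
theorem det_one_add_pos_of_norm_lt_one {E : Type*} [NormedAddCommGroup E]
    [NormedSpace ℝ E] [FiniteDimensional ℝ E] (f : E →L[ℝ] E) (hf : ‖f‖ < 1) :
    0 < (1 + f).det := by
  have : CompleteSpace E := FiniteDimensional.complete ℝ E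
  obtain ⟨p, -, hp⟩ := exists_polynomial_eval_eq_det_one_add_smul f
  have hne : ∀ t ∈ Set.Icc (0 : ℝ) 1, p.eval t ≠ 0 := by
    intro t ht
    have hu : IsUnit (1 + t • f) := by
      have : ‖-(t • f)‖ < 1 := by
        rw [norm_neg, norm_smul, Real.norm_of_nonneg ht.1]
        nlinarith [ht.1, ht.2, norm_nonneg f]
      simpa using isUnit_one_sub_of_norm_lt_one this
    rw [hp]
    obtain ⟨u, hu⟩ := hu
    rw [← hu]
    have h1 : ((u : E →L[ℝ] E) : E →ₗ[ℝ] E) * ((↑u⁻¹ : E →L[ℝ] E) : E →ₗ[ℝ] E) = 1 := by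
      rw [← ContinuousLinearMap.toLinearMap_mul, u.mul_inv]; rfl
    have h2 := congrArg LinearMap.det h1
    rw [map_mul, map_one] at h2
    exact left_ne_zero_of_mul (h2 ▸ one_ne_zero)
  have h0 : 0 < p.eval 0 := by
    rw [hp, zero_smul, add_zero]
    simp [ContinuousLinearMap.det]
  by_contra hneg
  have h1 : p.eval 1 ≤ 0 := by rw [hp, one_smul]; exact not_lt.1 hneg
  obtain ⟨t, ht, hpt⟩ := intermediate_value_Icc' zero_le_one p.continuous.continuousOn
    (show (0 : ℝ) ∈ Set.Icc (p.eval 1) (p.eval 0) from ⟨h1, h0.le⟩)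
  exact hne t ht hpt

/-! ### Small Lipschitz perturbations of the identity supported in a ball -/

/-- Solving `x + g x = y` amounts to finding a fixed point of the contraction `x ↦ y - g x`. -/
theorem LipschitzWith.bijective_id_add {E : Type*} [NormedAddCommGroup E] [CompleteSpace E]
    {g : E → E} {K : NNReal} (hg : LipschitzWith K g) (hK : K < 1) :
    Function.Bijective fun x => x + g x := by
  constructor
  · intro x y hxy
    by_contra hne
    have h1 : dist x y = dist (g x) (g y) := by
      rw [dist_eq_norm, dist_eq_norm, ← norm_neg (g x - g y)]
      congr 1
      have : x + g x = y + g y := hxy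
      rw [neg_sub, sub_eq_sub_iff_add_eq_add, this, add_comm]
    have h2 := hg.dist_le_mul x y
    have h3 : 0 < dist x y := dist_pos.2 hne
    have h4 : (K : ℝ) < 1 := by exact_mod_cast hK
    nlinarith
  · intro y
    have hc : ContractingWith K fun x => y - g x := by
      refine ⟨hK, LipschitzWith.of_dist_le_mul fun a b => ?_⟩
      rw [dist_sub_left]
      exact hg.dist_le_mul a b
    have : Nonempty E := ⟨y⟩
    refine ⟨hc.fixedPoint, ?_⟩
    have h := hc.fixedPoint_isFixedPt
    have h' : y - g hc.fixedPoint = hc.fixedPoint := h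
    calc hc.fixedPoint + g hc.fixedPoint = (y - g hc.fixedPoint) + g hc.fixedPoint := by rw [h']
      _ = y := sub_add_cancel _ _

theorem Function.Bijective.image_eq_of_eqOn_compl {α : Type*} {f : α → α}
    (hf : Function.Bijective f) {s : Set α} (h : ∀ x ∉ s, f x = x) : f '' s = s := by
  ext y
  constructor
  · rintro ⟨x, hx, rfl⟩
    by_contra hy
    have : f x = x := hf.1 (h _ hy)
    exact hy (this.symm ▸ hx)
  · intro hy
    obtain ⟨x, rfl⟩ := hf.2 y
    refine ⟨x, ?_, rfl⟩
    by_contra hx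
    exact hx (h x hx ▸ hy)

/-- Change of variables: `x ↦ x + t • g x` permutes `s` and has positive Jacobian. -/
theorem setIntegral_det_one_add_smul_fderiv {E : Type*} [NormedAddCommGroup E]
    [NormedSpace ℝ E] [FiniteDimensional ℝ E] [MeasurableSpace E] [BorelSpace E]
    (μ : MeasureTheory.Measure E) [μ.IsAddHaarMeasure] {s : Set E} (hs : IsOpen s)
    {g : E → E} {K : NNReal} (hg : LipschitzWith K g) (hd : ∀ x ∈ s, DifferentiableAt ℝ g x)
    (h0 : ∀ x ∉ s, g x = 0) {t : ℝ} (ht : 0 ≤ t) (htK : t * K < 1) :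
    ∫ x in s, (1 + t • fderiv ℝ g x).det ∂μ = μ.real s := by
  have : CompleteSpace E := FiniteDimensional.complete ℝ E
  have hbij : Function.Bijective fun x => x + t • g x := by
    have hL : LipschitzWith (t.toNNReal * K) fun x => t • g x :=
      LipschitzWith.of_dist_le_mul fun x y => by
        rw [dist_smul₀, Real.norm_of_nonneg ht, NNReal.coe_mul, Real.coe_toNNReal t ht,
          mul_assoc]
        exact mul_le_mul_of_nonneg_left (hg.dist_le_mul x y) ht
    exact hL.bijective_id_add (by
      rw [← NNReal.coe_lt_coe, NNReal.coe_mul, Real.coe_toNNReal t ht]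
      exact htK)
  have himg : (fun x => x + t • g x) '' s = s :=
    hbij.image_eq_of_eqOn_compl fun x hx => by simp [h0 x hx]
  have hderiv : ∀ x ∈ s, HasFDerivWithinAt (fun x => x + t • g x) (1 + t • fderiv ℝ g x) s x :=
    fun x hx => ((hasFDerivAt_id x).add ((hd x hx).hasFDerivAt.const_smul t)).hasFDerivWithinAt
  have key := MeasureTheory.integral_image_eq_integral_abs_det_fderiv_smul μ hs.measurableSet
    hderiv hbij.1.injOn (fun _ => (1 : ℝ))
  rw [himg] at key
  simp only [MeasureTheory.integral_const, smul_eq_mul, mul_one,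
    MeasureTheory.measureReal_restrict_apply_univ] at key
  rw [key]
  refine MeasureTheory.setIntegral_congr_fun hs.measurableSet fun x _ => ?_
  refine (abs_of_pos (det_one_add_pos_of_norm_lt_one _ ?_)).symm
  rw [norm_smul, Real.norm_of_nonneg ht]
  exact (mul_le_mul_of_nonneg_left (norm_fderiv_le_of_lipschitz ℝ hg) ht).trans_lt htK

/-- A map that is Lipschitz on a closed ball and vanishes outside of the open ball is Lipschitz. -/
theorem LipschitzOnWith.lipschitzWith_of_eq_zero {E F : Type*} [NormedAddCommGroup E]
    [NormedSpace ℝ E] [NormedAddCommGroup F] {g : E → F} {K : NNReal} {R : ℝ}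
    (hg : LipschitzOnWith K g (Metric.closedBall 0 R)) (h0 : ∀ x, R ≤ ‖x‖ → g x = 0) :
    LipschitzWith K g := by
  have cross : ∀ x y : E, ‖x‖ ≤ R → R ≤ ‖y‖ → dist (g x) (g y) ≤ K * dist x y := by
    intro x y hx hy
    -- The segment from `x` to `y` meets the sphere at some `z`, where `g` vanishes as it does at
    -- `y`.
    have hc : Continuous fun t : ℝ => ‖AffineMap.lineMap x y t‖ := by fun_prop
    obtain ⟨t, ht, hR⟩ := intermediate_value_Icc zero_le_one hc.continuousOn
      (show R ∈ Set.Icc _ _ by simpa using ⟨hx, hy⟩)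
    set z : E := AffineMap.lineMap x y t
    have hR' : ‖z‖ = R := hR
    calc dist (g x) (g y) = dist (g x) (g z) := by rw [h0 y hy, h0 z hR'.ge]
      _ ≤ K * dist x z := hg.dist_le_mul x (by simpa using hx) z (by simpa using hR'.le)
      _ ≤ K * dist x y := by
        gcongr
        rw [dist_left_lineMap, Real.norm_of_nonneg ht.1]
        exact mul_le_of_le_one_left dist_nonneg ht.2
  refine LipschitzWith.of_dist_le_mul fun x y => ?_
  rcases le_total ‖x‖ R with hx | hx <;> rcases le_total ‖y‖ R with hy | hy
  · exact hg.dist_le_mul x (by simpa using hx) y (by simpa using hy)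
  · exact cross x y hx hy
  · rw [dist_comm, dist_comm x]; exact cross y x hy hx
  · rw [h0 x hx, h0 y hy, dist_self]; positivity

/-- A `C¹` map does not retract a closed ball onto its boundary. -/
theorem not_forall_norm_eq_of_contDiffAt {E : Type*} [NormedAddCommGroup E]
    [InnerProductSpace ℝ E] [FiniteDimensional ℝ E] {f : E → E} {R : ℝ} (hR : 0 < R)
    (hf : ∀ x ∈ Metric.closedBall (0 : E) R, ContDiffAt ℝ 1 f x)
    (hid : ∀ x, ‖x‖ = R → f x = x) : ¬ ∀ x, ‖x‖ ≤ R → ‖f x‖ = R := by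
  classical
  intro hnorm
  borelize E
  let μ : MeasureTheory.Measure E := MeasureTheory.volume
  let g : E → E := fun x => if ‖x‖ ≤ R then f x - x else 0
  have hg0 : ∀ x, R ≤ ‖x‖ → g x = 0 := by
    intro x hx
    rcases hx.eq_or_lt with hx | hx
    · simp [g, hid x hx.symm]
    · simp [g, hx.not_ge]
  have hsub : ∀ x ∈ Metric.closedBall (0 : E) R, ContDiffAt ℝ 1 (fun x => f x - x) x :=
    fun x hx => (hf x hx).sub contDiffAt_id
  obtain ⟨K, hK⟩ : ∃ K, LipschitzOnWith K (fun x => f x - x) (Metric.closedBall (0 : E) R) := by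
    refine LocallyLipschitzOn.exists_lipschitzOnWith_of_compact
      (isCompact_closedBall (0 : E) R) fun x hx => ?_
    obtain ⟨K, t, ht, h⟩ := (hsub x hx).exists_lipschitzOnWith
    exact ⟨K, t, mem_nhdsWithin_of_mem_nhds ht, h⟩
  have hgK : LipschitzWith K g := by
    refine LipschitzOnWith.lipschitzWith_of_eq_zero (R := R) (fun x hx y hy => ?_) hg0
    have hx' : ‖x‖ ≤ R := by simpa using hx
    have hy' : ‖y‖ ≤ R := by simpa using hy
    simpa [g, hx', hy'] using hK hx hy
  have hev : ∀ x ∈ Metric.ball (0 : E) R, g =ᶠ[𝓝 x] fun x => f x - x := by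
    intro x hx
    filter_upwards [Metric.isOpen_ball.mem_nhds hx] with y hy
    have hy' : ‖y‖ ≤ R := by simpa using (Metric.mem_ball.1 hy).le
    simp [g, hy']
  have hfd : ∀ x ∈ Metric.ball (0 : E) R, DifferentiableAt ℝ f x := fun x hx =>
    (hf x (Metric.ball_subset_closedBall hx)).differentiableAt one_ne_zero
  have hfderiv : ∀ x ∈ Metric.ball (0 : E) R, fderiv ℝ g x = fderiv ℝ f x - 1 := by
    intro x hx
    rw [(hev x hx).fderiv_eq]
    exact ((hfd x hx).hasFDerivAt.sub (hasFDerivAt_id x)).fderiv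
  have hgd : ∀ x ∈ Metric.ball (0 : E) R, DifferentiableAt ℝ g x := fun x hx =>
    (hev x hx).differentiableAt_iff.2 ((hfd x hx).sub differentiableAt_id)
  -- Differentiating ‖f‖² = R² shows that the range of Df(x) is orthogonal to f(x) ≠ 0.
  have hdet : ∀ x ∈ Metric.ball (0 : E) R, (1 + (1 : ℝ) • fderiv ℝ g x).det = 0 := by
    intro x hx
    rw [hfderiv x hx, one_smul, add_sub_cancel]
    have hconst : (fun y => inner ℝ (f y) (f y)) =ᶠ[𝓝 x] fun _ => R ^ 2 := by
      filter_upwards [Metric.isOpen_ball.mem_nhds hx] with y hy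
      rw [real_inner_self_eq_norm_sq, hnorm y (by simpa using (Metric.mem_ball.1 hy).le)]
    have horth : ∀ v, inner ℝ (f x) (fderiv ℝ f x v) = 0 := by
      intro v
      have h1 := (hfd x hx).hasFDerivAt.inner ℝ (hfd x hx).hasFDerivAt
      have h2 := h1.unique ((hasFDerivAt_const (R ^ 2) x).congr_of_eventuallyEq hconst)
      have h3 := congrArg (fun L => L v) h2
      simp [fderivInnerCLM_apply, real_inner_comm] at h3
      linarith
    by_contra hne
    have hsurj : Function.Surjective (fderiv ℝ f x) :=
      ((fderiv ℝ f x : E →ₗ[ℝ] E).equivOfDetNeZero hne).surjective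
    obtain ⟨v, hv⟩ := hsurj (f x)
    have := horth v
    rw [hv, real_inner_self_eq_norm_sq,
      hnorm x (by simpa using (Metric.mem_ball.1 hx).le)] at this
    exact (pow_pos hR 2).ne' this
  -- Nodes below 1/(K+1) satisfy tK < 1, so the volume formula holds at each of them.
  obtain ⟨s, w, hs, hw⟩ := exists_extrapolation_weights (Module.finrank ℝ E)
    (δ := 1 / (K + 1)) (by positivity)
  have hsK : ∀ t ∈ s, 0 ≤ t ∧ t * K < 1 := by
    intro t ht
    obtain ⟨h1, h2⟩ := hs t ht
    have hK0 : (0 : ℝ) ≤ K := K.coe_nonneg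
    rw [lt_div_iff₀ (by positivity)] at h2
    exact ⟨h1.le, by nlinarith⟩
  have hint : ∀ t : ℝ, MeasureTheory.IntegrableOn (fun x => (1 + t • fderiv ℝ g x).det)
      (Metric.ball (0 : E) R) μ := by
    intro t
    have hc : ContinuousOn (fun x => (1 + t • (fderiv ℝ f x - 1)).det)
        (Metric.closedBall (0 : E) R) := by
      refine ContinuousLinearMap.continuous_det.comp_continuousOn ?_
      have : ContinuousOn (fderiv ℝ f) (Metric.closedBall (0 : E) R) := fun x hx =>
        ((hf x hx).fderiv_right (m := 0) (by norm_num)).continuousAt.continuousWithinAt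
      fun_prop
    refine ((hc.integrableOn_compact (isCompact_closedBall _ _)).mono_set
      Metric.ball_subset_closedBall).congr_fun (fun x hx => ?_) Metric.isOpen_ball.measurableSet
    simp only [hfderiv x hx]
  have hcomb : ∀ x, (1 + (1 : ℝ) • fderiv ℝ g x).det =
      ∑ t ∈ s, w t * (1 + t • fderiv ℝ g x).det := by
    intro x
    obtain ⟨p, hp, hpe⟩ := exists_polynomial_eval_eq_det_one_add_smul (fderiv ℝ g x)
    simp only [← hpe]
    exact hw p hp
  -- Extrapolating the constant polynomial 1; hence the equal volumes at the nodes extrapolate to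
  -- the same volume at t = 1.
  have hone : ∑ t ∈ s, w t = 1 := by simpa using (hw 1 (by simp)).symm
  have hzero : ∫ x in Metric.ball (0 : E) R, (1 + (1 : ℝ) • fderiv ℝ g x).det ∂μ = 0 :=
    MeasureTheory.setIntegral_eq_zero_of_forall_eq_zero hdet
  simp only [hcomb] at hzero
  rw [MeasureTheory.integral_finsetSum _ fun t _ => (hint t).const_mul (w t)] at hzero
  simp only [MeasureTheory.integral_const_mul] at hzero
  rw [Finset.sum_congr rfl fun t ht => by
    rw [setIntegral_det_one_add_smul_fderiv μ Metric.isOpen_ball hgK hgd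
      (fun x hx => hg0 x (by simpa using hx)) (hsK t ht).1 (hsK t ht).2], ← Finset.sum_mul,
    hone, one_mul] at hzero
  have hpos : 0 < μ (Metric.ball (0 : E) R) := Metric.measure_ball_pos μ 0 hR
  exact (ENNReal.toReal_pos hpos.ne' MeasureTheory.measure_ball_lt_top.ne).ne' hzero

/-- **Brouwer's fixed point theorem** for bounded `C¹` maps. -/
theorem exists_fixedPoint_of_contDiff_of_norm_lt {E : Type*} [NormedAddCommGroup E]
    [InnerProductSpace ℝ E] [FiniteDimensional ℝ E] {G : E → E} (hG : ContDiff ℝ 1 G) {R : ℝ}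
    (hR : ∀ x, ‖G x‖ < R) : ∃ x, G x = x := by
  by_contra! hne
  have hR0 : 0 < R := (norm_nonneg _).trans_lt (hR 0)
  let u : E → E := fun x => x - G x
  have hu : ∀ x, 0 < ‖u x‖ := fun x => norm_pos_iff.2 (sub_ne_zero.2 (hne x).symm)
  -- `l x` is the larger root of ‖x + l u‖² = R², a quadratic in l with quarter discriminant `D x`:
  -- the ray from `G x` through `x` leaves the ball at `x + l x • u x`.
  let D : E → ℝ := fun x => inner ℝ x (u x) ^ 2 + ‖u x‖ ^ 2 * (R ^ 2 - ‖x‖ ^ 2)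
  let l : E → ℝ := fun x => (√(D x) - inner ℝ x (u x)) / ‖u x‖ ^ 2
  have hpos : ∀ x, ‖x‖ = R → 0 < inner ℝ x (u x) := by
    intro x hx
    have h1 := real_inner_le_norm x (G x)
    have h2 := hR x
    simp only [u, inner_sub_right, real_inner_self_eq_norm_sq]
    rw [hx] at h1 ⊢
    nlinarith
  have hD : ∀ x, ‖x‖ ≤ R → 0 < D x := by
    intro x hx
    rcases hx.eq_or_lt with hx | hx
    · simp only [D, hx, sub_self, mul_zero, add_zero]
      exact pow_pos (hpos x hx) 2
    · have : 0 < R ^ 2 - ‖x‖ ^ 2 := by nlinarith [norm_nonneg x]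
      have := mul_pos (pow_pos (hu x) 2) this
      positivity
  have hus : ContDiff ℝ 1 u := contDiff_id.sub hG
  refine not_forall_norm_eq_of_contDiffAt (f := fun x => x + l x • u x) hR0 ?_ ?_ ?_
  · intro x hx
    have hDs : ContDiff ℝ 1 D :=
      ((contDiff_id.inner ℝ hus).pow 2).add
        ((hus.norm_sq ℝ).mul (contDiff_const.sub (contDiff_id.norm_sq ℝ)))
    have hls : ContDiffAt ℝ 1 l x :=
      ((hDs.contDiffAt.sqrt (hD x (by simpa using hx)).ne').sub
        (contDiff_id.inner ℝ hus).contDiffAt).div (hus.norm_sq ℝ).contDiffAt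
        (pow_pos (hu x) 2).ne'
    exact contDiffAt_id.add (hls.smul hus.contDiffAt)
  · intro x hx
    have : l x = 0 := by
      simp only [l, D, hx, sub_self, mul_zero, add_zero, Real.sqrt_sq (hpos x hx).le, zero_div]
    simp [this]
  · intro x hx
    have hsq := Real.sq_sqrt (hD x hx).le
    have hlu : l x * ‖u x‖ ^ 2 = √(D x) - inner ℝ x (u x) :=
      div_mul_cancel₀ _ (pow_pos (hu x) 2).ne'
    have : ‖x + l x • u x‖ ^ 2 = R ^ 2 := by
      have hq := pow_pos (hu x) 2
      rw [norm_add_sq_real, inner_smul_right, norm_smul, mul_pow, Real.norm_eq_abs, sq_abs]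
      have hDx : D x = inner ℝ x (u x) ^ 2 + ‖u x‖ ^ 2 * (R ^ 2 - ‖x‖ ^ 2) := rfl
      refine mul_left_cancel₀ hq.ne' ?_
      have h1 : (l x * ‖u x‖ ^ 2 + inner ℝ x (u x)) ^ 2 = D x := by
        rw [hlu, sub_add_cancel, hsq]
      rw [hDx] at h1
      linear_combination h1
    exact (sq_eq_sq₀ (norm_nonneg _) hR0.le).1 this

/-! ### Brouwer's theorem on the standard simplex -/

theorem norm_toLp_le_one_of_mem_stdSimplex {ι : Type*} [Fintype ι] {x : ι → ℝ}
    (hx : x ∈ stdSimplex ℝ ι) : ‖WithLp.toLp 2 x‖ ≤ 1 := by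
  rw [EuclideanSpace.norm_eq, Real.sqrt_le_one, ← hx.2]
  refine Finset.sum_le_sum fun i _ => ?_
  have h1 : x i ≤ 1 := hx.2 ▸ Finset.single_le_sum (fun j _ => hx.1 j) (Finset.mem_univ i)
  simpa using pow_le_of_le_one (hx.1 i) h1 two_ne_zero

/-- A smooth approximation, for small `ε > 0`, of a retraction onto the standard simplex. -/
noncomputable def smoothToSimplex {ι : Type*} [Fintype ι] (ε : ℝ) (x : ι → ℝ) (i : ι) : ℝ :=
  (x i + √(x i ^ 2 + ε ^ 2)) / ∑ j, (x j + √(x j ^ 2 + ε ^ 2))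

theorem add_sqrt_sq_add_sq_pos {ε : ℝ} (hε : 0 < ε) (t : ℝ) : 0 < t + √(t ^ 2 + ε ^ 2) := by
  have h : |t| < √(t ^ 2 + ε ^ 2) := by
    rw [← Real.sqrt_sq_eq_abs]
    exact Real.sqrt_lt_sqrt (sq_nonneg t) (lt_add_of_pos_right _ (pow_pos hε 2))
  linarith [neg_abs_le t]

theorem sum_add_sqrt_sq_add_sq_pos {ι : Type*} [Fintype ι] [Nonempty ι] {ε : ℝ} (hε : 0 < ε)
    (x : ι → ℝ) : 0 < ∑ j, (x j + √(x j ^ 2 + ε ^ 2)) :=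
  Finset.sum_pos (fun j _ => add_sqrt_sq_add_sq_pos hε (x j)) Finset.univ_nonempty

theorem smoothToSimplex_mem {ι : Type*} [Fintype ι] [Nonempty ι] {ε : ℝ} (hε : 0 < ε)
    (x : ι → ℝ) : smoothToSimplex ε x ∈ stdSimplex ℝ ι := by
  have hs := sum_add_sqrt_sq_add_sq_pos hε x
  refine ⟨fun i => div_nonneg (add_sqrt_sq_add_sq_pos hε (x i)).le hs.le, ?_⟩
  simp only [smoothToSimplex]
  rw [← Finset.sum_div, div_self hs.ne']

theorem contDiff_smoothToSimplex {ι : Type*} [Fintype ι] [Nonempty ι] {ε : ℝ} (hε : 0 < ε) :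
    ContDiff ℝ 1 (smoothToSimplex ε : (ι → ℝ) → ι → ℝ) := by
  have h : ∀ i : ι, ContDiff ℝ 1 fun x : ι → ℝ => x i + √(x i ^ 2 + ε ^ 2) := fun i =>
    (contDiff_apply ℝ ℝ i).add ((((contDiff_apply ℝ ℝ i).pow 2).add contDiff_const).sqrt
      fun x => by positivity)
  exact contDiff_pi.2 fun i => (h i).div (ContDiff.sum fun j _ => h j)
    fun x => (sum_add_sqrt_sq_add_sq_pos hε x).ne'

/-- Joint convergence is needed because the approximate fixed points move with ε. -/
theorem tendsto_smoothToSimplex {ι : Type*} [Fintype ι] {x : ι → ℝ} (hx : x ∈ stdSimplex ℝ ι) :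
    Tendsto (fun p : ℝ × (ι → ℝ) => smoothToSimplex p.1 p.2) (𝓝 (0, x)) (𝓝 x) := by
  have h2 : ∀ i, x i + √(x i ^ 2 + 0 ^ 2) = 2 * x i := fun i => by
    rw [zero_pow two_ne_zero, add_zero, Real.sqrt_sq (hx.1 i), two_mul]
  have hsum : ∑ j, (x j + √(x j ^ 2 + 0 ^ 2)) = 2 := by
    simp only [h2, ← Finset.mul_sum, hx.2, mul_one]
  have hx0 : smoothToSimplex 0 x = x := by
    funext i
    rw [smoothToSimplex, hsum, h2, mul_div_cancel_left₀ _ two_ne_zero]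
  have hc : ContinuousAt (fun p : ℝ × (ι → ℝ) => smoothToSimplex p.1 p.2) (0, x) := by
    refine continuousAt_pi.2 fun i => ContinuousAt.div ?_ ?_ ?_
    · fun_prop
    · fun_prop
    · simp only [hsum]; exact two_ne_zero
  simpa only [hx0] using hc.tendsto

/-- **Brouwer's fixed point theorem** for `C¹` maps of the standard simplex. -/
theorem exists_fixedPoint_of_mapsTo_stdSimplex {ι : Type*} [Fintype ι] [Nonempty ι]
    {C : (ι → ℝ) → ι → ℝ} (hC : ContDiff ℝ 1 C)
    (hmaps : Set.MapsTo C (stdSimplex ℝ ι) (stdSimplex ℝ ι)) :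
    ∃ x ∈ stdSimplex ℝ ι, C x = x := by
  have happrox : ∀ n : ℕ, ∃ x ∈ stdSimplex ℝ ι,
      C (smoothToSimplex (1 / ((n : ℝ) + 1)) x) = x := by
    intro n
    have hε : 0 < 1 / ((n : ℝ) + 1) := Nat.one_div_pos_of_nat
    have hmem : ∀ y, C (smoothToSimplex (1 / ((n : ℝ) + 1)) y) ∈ stdSimplex ℝ ι :=
      fun y => hmaps (smoothToSimplex_mem hε y)
    -- Any R > 1 works, as the simplex lies in the closed unit ball. The fixed point is a value of
    -- `C` on the simplex, hence lies in it.
    obtain ⟨x, hx⟩ := exists_fixedPoint_of_contDiff_of_norm_lt (R := 2)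
      (G := fun x : EuclideanSpace ℝ ι =>
        WithLp.toLp 2 (C (smoothToSimplex (1 / ((n : ℝ) + 1)) (WithLp.ofLp x))))
      (PiLp.contDiff_toLp.comp
        (hC.comp ((contDiff_smoothToSimplex hε).comp PiLp.contDiff_ofLp)))
      (fun x => (norm_toLp_le_one_of_mem_stdSimplex (hmem _)).trans_lt one_lt_two)
    have hx' := congrArg WithLp.ofLp hx
    exact ⟨WithLp.ofLp x, hx' ▸ hmem _, hx'⟩
  choose x hx hfix using happrox
  obtain ⟨a, ha, φ, hφ, hlim⟩ := (isCompact_stdSimplex ℝ ι).tendsto_subseq hx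
  refine ⟨a, ha, ?_⟩
  have hε : Tendsto (fun n => 1 / ((φ n : ℝ) + 1)) atTop (𝓝 0) :=
    tendsto_one_div_add_atTop_nhds_zero_nat.comp hφ.tendsto_atTop
  have h1 := (hC.continuous.tendsto a).comp
    ((tendsto_smoothToSimplex ha).comp (hε.prodMk_nhds hlim))
  refine tendsto_nhds_unique (h1.congr fun n => ?_) hlim
  exact hfix (φ n)

/-! ### Lower bounds for coefficients of products -/

theorem PowerSeries.sum_range_le_coeff_mul {p F : PowerSeries ℝ} (hp : ∀ n, 0 ≤ coeff n p)
    (hF : ∀ n, 0 ≤ coeff n F) {d n : ℕ} (hdn : d ≤ n + 1) :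
    ∑ i ∈ Finset.range d, coeff i p * coeff (n - i) F ≤ coeff n (p * F) := by
  rw [coeff_mul, Finset.Nat.sum_antidiagonal_eq_sum_range_succ_mk]
  exact Finset.sum_le_sum_of_subset_of_nonneg (Finset.range_mono hdn)
    fun i _ _ => mul_nonneg (hp i) (hF _)

/-- The first and last `d` terms of the convolution are disjoint since `2 * d ≤ n + 1`, and
reflection makes their sums equal. -/
theorem PowerSeries.two_mul_sum_range_le_coeff_sq {F : PowerSeries ℝ}
    (hF : ∀ n, 0 ≤ coeff n F) {d n : ℕ} (hdn : 2 * d ≤ n + 1) :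
    2 * ∑ i ∈ Finset.range d, coeff i F * coeff (n - i) F ≤ coeff n (F ^ 2) := by
  rw [sq, coeff_mul, Finset.Nat.sum_antidiagonal_eq_sum_range_succ_mk, two_mul]
  have hsplit := Finset.sum_range_add_sum_Ico
    (fun i => coeff i F * coeff (n - i) F) (show d ≤ n.succ by omega)
  rw [← hsplit]
  refine add_le_add le_rfl ?_
  have hrefl : ∑ i ∈ Finset.range d, coeff i F * coeff (n - i) F =
      ∑ i ∈ Finset.Ico (n + 1 - d) (n + 1), coeff i F * coeff (n - i) F := by
    have h := Finset.sum_Ico_reflect (fun i => coeff i F * coeff (n - i) F) 0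
      (show d ≤ n + 1 by omega)
    rw [Nat.sub_zero, ← Finset.range_eq_Ico] at h
    rw [← h]
    refine Finset.sum_congr rfl fun i hi => ?_
    have := Finset.mem_range.1 hi
    rw [Nat.sub_sub_self (by omega), mul_comm]
  rw [hrefl]
  exact Finset.sum_le_sum_of_subset_of_nonneg (Finset.Ico_subset_Ico_left (by omega))
    fun i _ _ => mul_nonneg (hF i) (hF _)

/-! ### Limits of quotients of coefficients -/

theorem eventually_ne_zero_of_tendsto_div {a : ℕ → ℝ} {c : ℝ} (hc : c ≠ 0)
    (h : Tendsto (fun n => a (n + 1) / a n) atTop (𝓝 c)) : ∀ᶠ n in atTop, a n ≠ 0 := by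
  filter_upwards [h.eventually_ne hc] with n hn h0
  exact hn (by rw [h0, div_zero])

theorem tendsto_sub_div_of_tendsto_div {a : ℕ → ℝ} {r : ℝ} (hr : r ≠ 0)
    (h : Tendsto (fun n => a (n + 1) / a n) atTop (𝓝 (1 / r))) (m : ℕ) :
    Tendsto (fun n => a (n - m) / a n) atTop (𝓝 (r ^ m)) := by
  have hne := eventually_ne_zero_of_tendsto_div (one_div_ne_zero hr) h
  -- Shifting the index removes the truncated subtraction; the quotient then telescopes into `m`
  -- factors tending to `r`.
  rw [← tendsto_add_atTop_iff_nat m]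
  simp only [Nat.add_sub_cancel]
  induction m with
  | zero =>
    refine tendsto_const_nhds.congr' ?_
    filter_upwards [hne] with n hn
    simp [div_self hn]
  | succ m ih =>
    have h1 := (h.comp (tendsto_add_atTop_nat m)).inv₀ (one_div_ne_zero hr)
    rw [one_div, inv_inv] at h1
    rw [pow_succ]
    refine (ih.mul h1).congr' ?_
    filter_upwards [(tendsto_add_atTop_nat m).eventually hne] with n hn
    simp only [Function.comp_apply, inv_div, ← add_assoc]
    exact div_mul_div_cancel₀ hn

/-! ### The cut operator preserves the simplex -/

namespace QuadSystem

variable {N : ℕ}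

theorem IsQuadratic.r_pos {S : QuadSystem N} (hS : S.IsQuadratic) : 0 < S.r :=
  one_div_pos.1 (zero_lt_one.trans hS.one_lt)

theorem IsQuadratic.Z_ne_zero {S : QuadSystem N} (hS : S.IsQuadratic) : S.Z ≠ 0 := by
  intro h
  obtain ⟨n, hn⟩ := (eventually_ne_zero_of_tendsto_div
    (a := fun n => PowerSeries.coeff n S.Z) (one_div_ne_zero hS.r_pos.ne')
    hS.tendsto_r).exists
  exact hn (by rw [h, map_zero])

/-- Only nonnegative terms of gZ and hZ² are dropped; f stays whole, as its coefficients may be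
negative. -/
theorem IsQuadratic.coeff_Z_le {S : QuadSystem N} (hS : S.IsQuadratic) (hn : S.IsNonneg)
    (d e s n : ℕ) (hdn : d + e + 2 * (s + 1) ≤ n) :
    PowerSeries.coeff n S.f
      + ∑ i ∈ Finset.range d, S.g.coeff i * PowerSeries.coeff (n - i) S.Z
      + ∑ i ∈ Finset.range e, S.h.coeff i * (2 * ∑ m ∈ Finset.range (s + 1),
          PowerSeries.coeff m S.Z * PowerSeries.coeff (n - (i + m)) S.Z)
      ≤ PowerSeries.coeff n S.Z := by
  conv_rhs => rw [hS.eq_Z, map_add, map_add]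
  have hg : ∀ n, 0 ≤ PowerSeries.coeff n (S.g : PowerSeries ℝ) := by simpa using hn.g_nonneg
  have hh : ∀ n, 0 ≤ PowerSeries.coeff n (S.h : PowerSeries ℝ) := by simpa using hn.h_nonneg
  have hZ2 : ∀ n, 0 ≤ PowerSeries.coeff n (S.Z ^ 2) := fun n => by
    simpa using PowerSeries.two_mul_sum_range_le_coeff_sq hn.Z_nonneg (d := 0) (n := n)
      (Nat.zero_le _)
  have h1 := PowerSeries.sum_range_le_coeff_mul hg hn.Z_nonneg (show d ≤ n + 1 by omega)
  have h2 := PowerSeries.sum_range_le_coeff_mul hh hZ2 (show e ≤ n + 1 by omega)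
  simp only [Polynomial.coeff_coe] at h1 h2
  refine add_le_add (add_le_add le_rfl h1) (le_trans ?_ h2)
  refine Finset.sum_le_sum fun i hi => mul_le_mul_of_nonneg_left ?_ (hn.h_nonneg i)
  have hi' := Finset.mem_range.1 hi
  simp only [← Nat.sub_sub]
  exact PowerSeries.two_mul_sum_range_le_coeff_sq hn.Z_nonneg (by omega)

theorem IsQuadratic.zeta_nonneg {S : QuadSystem N} (hS : S.IsQuadratic) (hn : S.IsNonneg)
    (s : ℕ) : 0 ≤ S.zeta s := by
  have hr := hS.r_pos.ne'
  have hlim : ∀ m, Tendsto (fun n => PowerSeries.coeff (n - m) S.Z / PowerSeries.coeff n S.Z)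
      atTop (𝓝 (S.r ^ m)) := tendsto_sub_div_of_tendsto_div
        (a := fun n => PowerSeries.coeff n S.Z) hr hS.tendsto_r
  have hne := eventually_ne_zero_of_tendsto_div
    (a := fun n => PowerSeries.coeff n S.Z) (one_div_ne_zero hr) hS.tendsto_r
  have key := (hS.tendsto_γ.add (tendsto_finsetSum (Finset.range (S.g.natDegree + 1))
    fun i _ => (hlim i).const_mul (S.g.coeff i))).add
    (tendsto_finsetSum (Finset.range (S.h.natDegree + 1)) fun i _ =>
      ((tendsto_finsetSum (Finset.range (s + 1)) fun m _ =>
        (hlim (i + m)).const_mul (PowerSeries.coeff m S.Z)).const_mul 2).const_mul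
          (S.h.coeff i))
  have hle := le_of_tendsto key (b := 1) (by
    filter_upwards [hne, eventually_ge_atTop
      (S.g.natDegree + 1 + (S.h.natDegree + 1) + 2 * (s + 1))] with n hn0 hge
    have hpos : 0 < PowerSeries.coeff n S.Z := (hn.Z_nonneg n).lt_of_ne' hn0
    have := (div_le_one hpos).2 (hS.coeff_Z_le hn _ _ s n hge)
    refine le_trans (le_of_eq ?_) this
    simp only [add_div, Finset.sum_div, mul_div_assoc])
  have hg : ∑ i ∈ Finset.range (S.g.natDegree + 1), S.g.coeff i * S.r ^ i = S.g.eval S.r :=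
    (Polynomial.eval_eq_sum_range _).symm
  have hh : ∑ i ∈ Finset.range (S.h.natDegree + 1), S.h.coeff i * (2 *
      ∑ m ∈ Finset.range (s + 1), PowerSeries.coeff m S.Z * S.r ^ (i + m)) =
      2 * S.h.eval S.r * cutEval S.Z s S.r := by
    rw [Polynomial.eval_eq_sum_range, cutEval, mul_assoc, Finset.sum_mul_sum, Finset.mul_sum]
    refine Finset.sum_congr rfl fun i _ => ?_
    simp only [Finset.mul_sum]
    exact Finset.sum_congr rfl fun m _ => by ring
  rw [hg, hh] at hle
  rw [zeta]
  linarith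

theorem IsNaturalPartition.sum_γA {S : QuadSystem N} (hp : S.IsNaturalPartition)
    (hS : S.IsQuadratic) : ∑ i, S.γA i = S.γ := by
  refine tendsto_nhds_unique (tendsto_finsetSum Finset.univ fun i _ => hS.tendsto_γA i)
    (hS.tendsto_γ.congr fun n => ?_)
  rw [hp.sum_f, map_sum, Finset.sum_div]

theorem IsNaturalPartition.sum_cutEval {S : QuadSystem N} (hp : S.IsNaturalPartition) (s : ℕ)
    (r : ℝ) : ∑ i, cutEval (S.A i) s r = cutEval S.Z s r := by
  simp only [cutEval]
  rw [Finset.sum_comm, hp.sum_A]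
  simp only [map_sum, Finset.sum_mul]

/-- Only the symmetrization of `h_{ijk}` in `j, k` matters for symmetric coefficients. -/
theorem IsNaturalPartition.sum_hA_mul {S : QuadSystem N} (hp : S.IsNaturalPartition) (r : ℝ)
    (q : Fin N → Fin N → ℝ) (hq : ∀ j k, q j k = q k j) :
    ∑ i, ∑ j, ∑ k, (S.hA i j k).eval r * q j k = ∑ j, ∑ k, q j k := by
  have hsum : ∀ j k, ∑ i, (S.hA i j k).eval r + ∑ i, (S.hA i k j).eval r = 2 := by
    intro j k
    have := congrArg (Polynomial.eval r) (hp.sum_h j k)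
    simpa [Polynomial.eval_finsetSum, Finset.sum_add_distrib] using this.symm
  have h1 : ∑ i, ∑ j, ∑ k, (S.hA i j k).eval r * q j k =
      ∑ j, ∑ k, (∑ i, (S.hA i j k).eval r) * q j k := by
    rw [Finset.sum_comm]
    refine Finset.sum_congr rfl fun j _ => ?_
    rw [Finset.sum_comm]
    simp only [Finset.sum_mul]
  -- The sum over `i` is known only after symmetrizing, so the total is averaged with its copy under
  -- j ↔ k.
  have h2 : ∑ j, ∑ k, (∑ i, (S.hA i j k).eval r) * q j k =
      ∑ j, ∑ k, (∑ i, (S.hA i k j).eval r) * q j k := by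
    rw [Finset.sum_comm]
    exact Finset.sum_congr rfl fun j _ => Finset.sum_congr rfl fun k _ => by rw [hq]
  have h3 : ∑ j, ∑ k, (∑ i, (S.hA i j k).eval r) * q j k +
      ∑ j, ∑ k, (∑ i, (S.hA i k j).eval r) * q j k = 2 * ∑ j, ∑ k, q j k := by
    simp only [← Finset.sum_add_distrib, ← add_mul, hsum, Finset.mul_sum]
  rw [h1]
  linarith

theorem sum_cutOperator {S : QuadSystem N} (hS : S.IsQuadratic) (hp : S.IsNaturalPartition)
    (s : ℕ) {x : Fin N → ℝ} (hx : ∑ i, x i = 1) : ∑ i, S.cutOperator s x i = 1 := by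
  simp only [cutOperator, Finset.sum_add_distrib]
  have hg : ∑ i, ∑ j, (S.gA i j).eval S.r * x j = S.g.eval S.r := by
    rw [Finset.sum_comm]
    have : ∀ j, ∑ i, (S.gA i j).eval S.r * x j = S.g.eval S.r * x j := fun j => by
      rw [hp.sum_g j, Polynomial.eval_finsetSum, Finset.sum_mul]
    simp only [this, ← Finset.mul_sum, hx, mul_one]
  have hlin : ∑ i, ∑ j, ∑ k, S.h.eval S.r * (S.hA i j k).eval S.r
      * (cutEval (S.A j) s S.r * x k + cutEval (S.A k) s S.r * x j) =
      2 * S.h.eval S.r * cutEval S.Z s S.r := by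
    have := hp.sum_hA_mul S.r (fun j k => S.h.eval S.r *
      (cutEval (S.A j) s S.r * x k + cutEval (S.A k) s S.r * x j)) fun j k => by ring
    calc _ = _ := Finset.sum_congr rfl fun i _ => Finset.sum_congr rfl fun j _ =>
          Finset.sum_congr rfl fun k _ => by ring
      _ = _ := this
      _ = _ := by
        simp only [← Finset.mul_sum, Finset.sum_add_distrib, ← Finset.sum_mul, hx,
          hp.sum_cutEval]
        ring
  have hquad : ∑ i, ∑ j, ∑ k, S.zeta s * (S.hA i j k).eval S.r * x j * x k = S.zeta s := by
    have := hp.sum_hA_mul S.r (fun j k => S.zeta s * (x j * x k)) fun j k => by ring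
    calc _ = _ := Finset.sum_congr rfl fun i _ => Finset.sum_congr rfl fun j _ =>
          Finset.sum_congr rfl fun k _ => by ring
      _ = _ := this
      _ = _ := by simp only [← Finset.mul_sum, hx, mul_one]
  rw [hp.sum_γA hS, hg, hlin, hquad, zeta]
  ring

theorem cutOperator_nonneg {S : QuadSystem N} (hS : S.IsQuadratic) (hn : S.IsNonneg)
    (s : ℕ) {x : Fin N → ℝ} (hx : ∀ i, 0 ≤ x i) (i : Fin N) : 0 ≤ S.cutOperator s x i := by
  have heval : ∀ p : Polynomial ℝ, (∀ n, 0 ≤ p.coeff n) → 0 ≤ p.eval S.r := fun p hp => by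
    rw [Polynomial.eval_eq_sum_range]
    exact Finset.sum_nonneg fun m _ => mul_nonneg (hp m) (pow_nonneg hS.r_pos.le m)
  have hcut : ∀ j, 0 ≤ cutEval (S.A j) s S.r := fun j =>
    Finset.sum_nonneg fun m _ => mul_nonneg (hn.A_nonneg j m) (pow_nonneg hS.r_pos.le m)
  have hh := heval _ hn.h_nonneg
  have hhA := fun j k => heval _ (hn.hA_nonneg i j k)
  have hζ := hS.zeta_nonneg hn s
  refine add_nonneg (add_nonneg (add_nonneg (hn.γA_nonneg i) ?_) ?_) ?_
  · exact Finset.sum_nonneg fun j _ => mul_nonneg (heval _ (hn.gA_nonneg i j)) (hx j)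
  · exact Finset.sum_nonneg fun j _ => Finset.sum_nonneg fun k _ =>
      mul_nonneg (mul_nonneg hh (hhA j k))
        (add_nonneg (mul_nonneg (hcut j) (hx k)) (mul_nonneg (hcut k) (hx j)))
  · exact Finset.sum_nonneg fun j _ => Finset.sum_nonneg fun k _ =>
      mul_nonneg (mul_nonneg (mul_nonneg hζ (hhA j k)) (hx j)) (hx k)

theorem contDiff_cutOperator (S : QuadSystem N) (s : ℕ) : ContDiff ℝ 1 (S.cutOperator s) := by
  refine contDiff_pi.2 fun i => ?_
  unfold cutOperator
  fun_prop

end QuadSystem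

theorem unitSimplex_eq_stdSimplex (N : ℕ) : unitSimplex N = stdSimplex ℝ (Fin N) := by
  ext x
  refine ⟨fun h => ⟨fun i => (h.1 i).1, h.2⟩, fun h => ⟨fun i => ⟨h.1 i, ?_⟩, h.2⟩⟩
  exact h.2 ▸ Finset.single_le_sum (fun j _ => h.1 j) (Finset.mem_univ i)

theorem proposition4p9 (N : ℕ) (S : QuadSystem N) (hS : S.IsQuadratic)
    (hpart : S.IsNaturalPartition) (hnonneg : S.IsNonneg) (s : ℕ) :
    Set.MapsTo (S.cutOperator s) (unitSimplex N) (unitSimplex N) ∧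
      ∃ x ∈ unitSimplex N, S.IsCutSolution s x := by
  rw [unitSimplex_eq_stdSimplex]
  have hmaps : Set.MapsTo (S.cutOperator s) (stdSimplex ℝ (Fin N)) (stdSimplex ℝ (Fin N)) :=
    fun x hx => ⟨QuadSystem.cutOperator_nonneg hS hnonneg s hx.1,
      QuadSystem.sum_cutOperator hS hpart s hx.2⟩
  -- For N = 0 the simplex is empty; this case is excluded because Z, as an empty sum, would vanish.
  have : Nonempty (Fin N) := by
    by_contra hempty
    have := not_nonempty_iff.1 hempty
    exact hS.Z_ne_zero (by rw [hpart.sum_A, Finset.univ_eq_empty, Finset.sum_empty])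
  exact ⟨hmaps, exists_fixedPoint_of_mapsTo_stdSimplex (S.contDiff_cutOperator s) hmaps⟩
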